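/- **Conventions.** Let $\mathcal Z$ be a set of data points, $\mathcal D^*=\bigcup_{n\ge 0}\mathcal Z^n$ the set of datasets, and let a mechanism be a map $\mathcal M$ that assigns to each dataset in its domain a probability distribution on a measurable space $\mathcal O$. For probability distributions $P,Q$ on one measurable space and $\alpha\ge 0$ the hockey-stick divergence is $H_\alpha(P\|Q)=\mathbb E_{o\sim Q}\big[(\tfrac{dP}{dQ}(o)-\alpha)_+\big]$, where the part of $P$ that is singular with respect to $Q$ contributes its whole mass; that is, $H_\alpha(P\|Q)=\int (p-\alpha q)_+\,d\mu$ for densities $p,q$ of $P,Q$ with respect to a common dominating measure $\mu$. The pair $(P,Q)$ *dominates* $\mathcal M$ for a (possibly asymmetric) neighbouring relation $\simeq$ if $\sup_{D\simeq D'}H_\alpha(\mathcal M(D)\|\mathcal M(D'))\le H_\alpha(P\|Q)$ for all $\alpha\ge 0$. Here $D,D'$ are *add neighbours* if $D'$ arises from $D$ by inserting one data point (at any position), *removal neighbours* if $D'$ arises from $D$ by deleting one data point, and *replace neighbours* if $D'$ arises from $D$ by deleting one data point and inserting one data point. *Poisson sampling* $S^{\gamma}_{\mathrm{Poisson}}$,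 $0\le\gamma\le 1$, keeps each data point of a dataset independently with probability $\gamma$. *Subset sampling* $S_{\mathrm{Subset}}^{\gamma}$, for integers $0\le m<n$ and $\gamma:=m/n$, takes a dataset of size $n$ or $n-1$ and returns a sub-dataset of size $m$ chosen uniformly at random. Sampled data points keep their order. $\mathcal M\circ S$ runs $\mathcal M$ on the sampled dataset. **Theorem (amplification by sampling for dominating pairs).** Let $\mathcal M$ be a mechanism defined on all of $\mathcal D^*$ and let $P,Q$ be probability distributions on a measurable space. 1. Let $0\le\gamma\le1$. If $(P,Q)$ dominates $\mathcal M$ for add neighbours, then $(P,(1-\gamma)P+\gamma Q)$ dominates $\mathcal M\circ S^{\gamma}_{\mathrm{Poisson}}$ for add neighbours and $((1-\gamma)P+\gamma Q,\,P)$ dominates $\mathcal M\circ S^{\gamma}_{\mathrm{Poisson}}$ for removal neighbours. If $(P,Q)$ dominates $\mathcal M$ for removal neighbours, then $((1-\gamma)Q+\gamma P,\,Q)$ dominates $\mathcal M\circ S^{\gamma}_{\mathrm{Poisson}}$ for removal neighbours. 2. Let $0\le m<n$ be integers and $\gamma=m/n$. If $(P,Q)$ dominates $\mathcal M$ for replace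 neighbours, then $(P,(1-\gamma)P+\gamma Q)$ dominates $\mathcal M\circ S^{\gamma}_{\mathrm{Subset}}$ for add neighbours and $((1-\gamma)P+\gamma Q,\,P)$ dominates $\mathcal M\circ S^{\gamma}_{\mathrm{Subset}}$ for removal neighbours, both among datasets of size $n$ or $n-1$. -/

import Mathlib

open MeasureTheory
open scoped ENNReal NNReal

noncomputable section

namespace DominatingPair

/-- Hockey-stick divergence `H_α(P ‖ Q) = 𝔼_{o ∼ Q} [(dP/dQ (o) - α)₊]`, with the usual convention
that `dP/dQ = ∞` on the part of `P` that is singular to `Q`, so that this part contributes its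
full `P`-mass; for `p = dP/dμ`, `q = dQ/dμ` this is `∫ (p - α q)₊ dμ`.
Subtraction in `ℝ≥0∞` is truncated, hence it is the positive part. -/
def hockeyStick {𝒴 : Type*} [MeasurableSpace 𝒴] (α : ℝ≥0) (P Q : Measure 𝒴) : ℝ≥0∞ :=
  (∫⁻ o, (P.rnDeriv Q o - (α : ℝ≥0∞)) ∂Q) + P.singularPart Q Set.univ

/-- `(P, Q)` dominates the mechanism `M : 𝒟 → {distributions on 𝒪}` under the neighbouring
relation `R`. The supremum is taken in `ℝ≥0∞`, and it is `0` if there are no neighbours. -/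
def Dominates {𝒟 𝒪 𝒴 : Type*} [MeasurableSpace 𝒪] [MeasurableSpace 𝒴]
    (R : 𝒟 → 𝒟 → Prop) (M : 𝒟 → Measure 𝒪) (P Q : Measure 𝒴) : Prop :=
  ∀ α : ℝ≥0,
    (⨆ (D : 𝒟) (D' : 𝒟) (_ : R D D'), hockeyStick α (M D) (M D')) ≤ hockeyStick α P Q

/-- `D'` arises from the dataset `D` by adding one data point (at any position). -/
def AddNeighbor {Z : Type*} (D D' : List Z) : Prop :=
  ∃ (l₁ l₂ : List Z) (x : Z), D = l₁ ++ l₂ ∧ D' = l₁ ++ x :: l₂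

/-- `D'` arises from the dataset `D` by removing one data point. -/
def RemoveNeighbor {Z : Type*} (D D' : List Z) : Prop := AddNeighbor D' D

/-- `D'` arises from the dataset `D` by replacing one data point, that is, by removing one
data point and adding one data point. -/
def ReplaceNeighbor {Z : Type*} (D D' : List Z) : Prop :=
  ∃ E : List Z, RemoveNeighbor D E ∧ AddNeighbor E D'

/-- The mixture `(1 - γ) P + γ Q` (used for `γ ≤ 1`). -/
def mix {𝒴 : Type*} [MeasurableSpace 𝒴] (γ : ℝ≥0) (P Q : Measure 𝒴) : Measure 𝒴 :=
  (1 - γ) • P + γ • Q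

/-- The mechanism `M ∘ S`: draw `E ∼ S D` and run `M` on `E`. -/
def subsampled {𝒟 𝒟' 𝒪 : Type*} [MeasurableSpace 𝒪] (M : 𝒟 → Measure 𝒪) (S : 𝒟' → PMF 𝒟) :
    𝒟' → Measure 𝒪 :=
  fun D => Measure.sum fun E : 𝒟 => S D E • M E

/-- A coin that shows `true` with probability `γ`. -/
def coin (γ : ℝ≥0) (hγ : γ ≤ 1) : PMF Bool :=
  PMF.ofFintype (fun b => cond b (γ : ℝ≥0∞) ((1 - γ : ℝ≥0) : ℝ≥0∞)) (by
    rw [Fintype.sum_bool]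
    simp only [cond_true, cond_false]
    rw [← ENNReal.coe_add, add_tsub_cancel_of_le hγ, ENNReal.coe_one])

/-- Poisson sampling: each data point is kept independently with probability `γ`. -/
def poissonSample {Z : Type*} (γ : ℝ≥0) (hγ : γ ≤ 1) : List Z → PMF (List Z)
  | [] => PMF.pure []
  | x :: D => (coin γ hγ).bind fun b =>
      (poissonSample γ hγ D).map fun E => if b then x :: E else E

/-- The domain of subset sampling: datasets of size `n` or `n - 1`. -/
def SizedDataset (Z : Type*) (n : ℕ) : Type _ :=
  {D : List Z // D.length = n ∨ D.length + 1 = n}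

/-- Subset sampling: a sub-dataset of size `m < n`, uniform over all choices of `m` positions of
the given dataset of size `n` or `n - 1`. (`List.sublistsLen m D` lists the sub-datasets, one
entry for each choice of `m` positions.) -/
def subsetSample {Z : Type*} (n m : ℕ) (hm : m < n) (D : SizedDataset Z n) : PMF (List Z) :=
  PMF.ofMultiset (↑(List.sublistsLen m D.1) : Multiset (List Z)) (by
    have hD : m ≤ D.1.length := by
      rcases D.2 with h | h <;> omega
    intro h
    have h' : (List.sublistsLen m D.1).length = 0 := by
      rw [(Multiset.coe_eq_zero _).1 h, List.length_nil]
    rw [List.length_sublistsLen] at h'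
    exact (Nat.choose_pos hD).ne' h')

end DominatingPair

end

/-! Between probability measures, `H_α(μ‖ν) ≤ H_α(P‖Q)` for all `α ≥ 0` means that the planar set of
pairs `(μ A, ν A)` has a support function no larger than that of the pairs `(P B, Q B)`; this is
`SupportLE`. In this form the inequality is symmetric under swapping both pairs, stable under
averaging neighbouring pairs (`mul_mean_add_mul_mean_le`), and compatible with the linear map `(p,
q) ↦ (p, (1 - γ) p + γ q)` (`SupportLE.mix`).

It therefore suffices to write the output on the larger dataset as `(1 - γ) μ + γ ρ`, with `μ` the
output on the smaller one and `(μ, ρ)` an average of pairs of neighbouring outputs. For Poisson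
sampling, condition on whether the extra point is kept. For subset sampling, samples containing the
extra point `k` are matched with those of the smaller dataset: remove a uniform element of a uniform
`(m + 1)`-subset and insert `k`, which is a replacement (`average_powersetCard_le`). Removal
statements follow by swapping. -/

namespace DominatingPair

/-! ### Variational formula for the hockey-stick divergence -/

section HockeyStick

variable {𝒴 : Type*} [MeasurableSpace 𝒴]

theorem measure_le_hockeyStick_add (α : ℝ≥0) (P Q : Measure 𝒴) [IsFiniteMeasure P]
    [IsFiniteMeasure Q] {A : Set 𝒴} (hA : MeasurableSet A) :
    P A ≤ hockeyStick α P Q + α * Q A := by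
  have h1 : P A = P.singularPart Q A + ∫⁻ o in A, P.rnDeriv Q o ∂Q := by
    conv_lhs => rw [P.haveLebesgueDecomposition_add Q]
    rw [Measure.add_apply, withDensity_apply _ hA]
  have h2 : ∫⁻ o in A, P.rnDeriv Q o ∂Q
      ≤ (∫⁻ o, (P.rnDeriv Q o - (α : ℝ≥0∞)) ∂Q) + α * Q A := by
    calc ∫⁻ o in A, P.rnDeriv Q o ∂Q
        ≤ ∫⁻ o in A, ((P.rnDeriv Q o - (α : ℝ≥0∞)) + α) ∂Q :=
          lintegral_mono fun o => le_tsub_add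
      _ = (∫⁻ o in A, (P.rnDeriv Q o - (α : ℝ≥0∞)) ∂Q) + α * Q A := by
          rw [lintegral_add_right _ measurable_const, setLIntegral_const]
      _ ≤ _ := by gcongr; exact Measure.restrict_le_self
  rw [h1, hockeyStick, add_right_comm, add_comm (P.singularPart Q A)]
  exact add_le_add h2 (measure_mono (Set.subset_univ A))

/-- The supremum of `P B - α Q B` is attained where `dP/dQ > α`, enlarged by the `Q`-null set `Tᶜ`
that carries the singular part. The additive form avoids truncated subtraction. -/
theorem exists_hockeyStick_add_le (α : ℝ≥0) (P Q : Measure 𝒴) [IsFiniteMeasure P]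
    [IsFiniteMeasure Q] :
    ∃ B, MeasurableSet B ∧ hockeyStick α P Q + α * Q B ≤ P B := by
  obtain ⟨T, hT, hPT, hQT⟩ := P.mutuallySingular_singularPart Q
  have hrn := P.measurable_rnDeriv Q
  have hS : MeasurableSet {o | (α : ℝ≥0∞) < P.rnDeriv Q o} :=
    measurableSet_lt measurable_const hrn
  set S := {o | (α : ℝ≥0∞) < P.rnDeriv Q o} with hSdef
  have hB : MeasurableSet (Tᶜ ∪ S) := hT.compl.union hS
  refine ⟨Tᶜ ∪ S, hB, ?_⟩
  have hae : (Tᶜ ∪ S : Set 𝒴) =ᵐ[Q] S := union_ae_eq_right.2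
    (measure_mono_null Set.sdiff_subset hQT)
  have h1 : P (Tᶜ ∪ S) = P.singularPart Q (Tᶜ ∪ S) + ∫⁻ o in S, P.rnDeriv Q o ∂Q := by
    conv_lhs => rw [P.haveLebesgueDecomposition_add Q]
    rw [Measure.add_apply, withDensity_apply _ hB, setLIntegral_congr hae]
  have h2 : P.singularPart Q Set.univ ≤ P.singularPart Q (Tᶜ ∪ S) := by
    rw [← Set.union_compl_self T]
    refine (measure_union_le _ _).trans ?_
    rw [hPT, zero_add]
    exact measure_mono Set.subset_union_left
  have h3 : ∫⁻ o, (P.rnDeriv Q o - (α : ℝ≥0∞)) ∂Q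
      = ∫⁻ o in S, (P.rnDeriv Q o - (α : ℝ≥0∞)) ∂Q := by
    refine (setLIntegral_eq_of_support_subset ?_).symm
    intro o ho
    exact tsub_pos_iff_lt.1 (pos_iff_ne_zero.2 ho)
  have h4 : (∫⁻ o in S, (P.rnDeriv Q o - (α : ℝ≥0∞)) ∂Q) + α * Q (Tᶜ ∪ S)
      = ∫⁻ o in S, P.rnDeriv Q o ∂Q := by
    rw [measure_congr hae, ← setLIntegral_const, ← lintegral_add_right _ measurable_const]
    exact setLIntegral_congr_fun hS fun o ho => tsub_add_cancel_of_le (le_of_lt ho)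
  rw [h1, hockeyStick, add_right_comm, h3, h4, add_comm]
  exact add_le_add_left h2 _

theorem hockeyStick_ne_top (α : ℝ≥0) (P Q : Measure 𝒴) [IsFiniteMeasure P]
    [IsFiniteMeasure Q] : hockeyStick α P Q ≠ ∞ := by
  obtain ⟨B, -, hB⟩ := exists_hockeyStick_add_le α P Q
  exact ne_top_of_le_ne_top (measure_ne_top P B) (le_self_add.trans hB)

theorem real_sub_le_hockeyStick (α : ℝ≥0) (P Q : Measure 𝒴) [IsFiniteMeasure P]
    [IsFiniteMeasure Q] {A : Set 𝒴} (hA : MeasurableSet A) :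
    P.real A - α * Q.real A ≤ (hockeyStick α P Q).toReal := by
  have hQ : (α : ℝ≥0∞) * Q A ≠ ∞ := ENNReal.mul_ne_top ENNReal.coe_ne_top (measure_ne_top Q A)
  have h := ENNReal.toReal_mono (ENNReal.add_ne_top.2 ⟨hockeyStick_ne_top α P Q, hQ⟩)
    (measure_le_hockeyStick_add α P Q hA)
  rw [ENNReal.toReal_add (hockeyStick_ne_top α P Q) hQ, ENNReal.toReal_mul,
    ENNReal.coe_toReal] at h
  simp only [Measure.real]
  linarith

theorem exists_hockeyStick_le_real_sub (α : ℝ≥0) (P Q : Measure 𝒴) [IsFiniteMeasure P]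
    [IsFiniteMeasure Q] :
    ∃ B, MeasurableSet B ∧ (hockeyStick α P Q).toReal ≤ P.real B - α * Q.real B := by
  obtain ⟨B, hB, h⟩ := exists_hockeyStick_add_le α P Q
  refine ⟨B, hB, ?_⟩
  have hQ : (α : ℝ≥0∞) * Q B ≠ ∞ := ENNReal.mul_ne_top ENNReal.coe_ne_top (measure_ne_top Q B)
  have h := ENNReal.toReal_mono (measure_ne_top P B) h
  rw [ENNReal.toReal_add (hockeyStick_ne_top α P Q) hQ, ENNReal.toReal_mul,
    ENNReal.coe_toReal] at h
  simp only [Measure.real]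
  linarith

end HockeyStick

/-! ### Support functions of ranges of pairs of measures -/

section SupportLE

variable {𝒪 𝒴 : Type*} [MeasurableSpace 𝒪] [MeasurableSpace 𝒴]

/-- Every linear functional is at most as large on the range of `(μ, ν)` as on the range of
`(P, Q)`. For probability measures this says `H_α(μ ‖ ν) ≤ H_α(P ‖ Q)` for all `α ≥ 0`. -/
def SupportLE (μ ν : Measure 𝒪) (P Q : Measure 𝒴) : Prop :=
  ∀ a b K : ℝ, (∀ B, MeasurableSet B → a * P.real B + b * Q.real B ≤ K) →
    ∀ A, MeasurableSet A → a * μ.real A + b * ν.real A ≤ K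

variable {μ ν ρ : Measure 𝒪} {P Q : Measure 𝒴}

theorem SupportLE.swap (h : SupportLE μ ν P Q) : SupportLE ν μ Q P := by
  intro a b K hK A hA
  rw [add_comm]
  exact h b a K (fun B hB => by rw [add_comm]; exact hK B hB) A hA

theorem SupportLE.hockeyStick_le [IsFiniteMeasure μ] [IsFiniteMeasure ν] [IsFiniteMeasure P]
    [IsFiniteMeasure Q] (h : SupportLE μ ν P Q) (α : ℝ≥0) :
    hockeyStick α μ ν ≤ hockeyStick α P Q := by
  rw [← ENNReal.toReal_le_toReal (hockeyStick_ne_top _ _ _) (hockeyStick_ne_top _ _ _)]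
  obtain ⟨A, hA, hle⟩ := exists_hockeyStick_le_real_sub α μ ν
  have := h 1 (-α) _ (fun B hB => by
    have := real_sub_le_hockeyStick α P Q hB
    linarith) A hA
  linarith

/-- Dividing by `a` turns the functional into `p - α q` with `α = -b / a ≥ 0`, whose maximum over
the range is the hockey-stick divergence. -/
theorem mul_add_mul_le_of_hockeyStick_le [IsFiniteMeasure μ] [IsFiniteMeasure ν]
    [IsFiniteMeasure P] [IsFiniteMeasure Q]
    (h : ∀ α : ℝ≥0, hockeyStick α μ ν ≤ hockeyStick α P Q) {a b K : ℝ} (ha : 0 < a) (hb : b ≤ 0)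
    (hK : ∀ B, MeasurableSet B → a * P.real B + b * Q.real B ≤ K) {A : Set 𝒪}
    (hA : MeasurableSet A) : a * μ.real A + b * ν.real A ≤ K := by
  obtain ⟨α, hα⟩ : ∃ α : ℝ≥0, a * (α : ℝ) = -b :=
    ⟨(-b / a).toNNReal, by
      rw [Real.coe_toNNReal _ (div_nonneg (by linarith) ha.le)]; field_simp⟩
  obtain ⟨B, hB, hle⟩ := exists_hockeyStick_le_real_sub α P Q
  have h1 := real_sub_le_hockeyStick α μ ν hA
  have h2 := ENNReal.toReal_mono (hockeyStick_ne_top α P Q) (h α)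
  have h3 := mul_le_mul_of_nonneg_left (h1.trans (h2.trans hle)) ha.le
  rw [mul_sub, mul_sub, ← mul_assoc, ← mul_assoc, hα] at h3
  linarith [hK B hB]

/-- Only coefficients of opposite sign need the hypothesis. For equal signs, and for `a = 0`, the
bounds at `∅` and `univ` suffice because all masses lie in `[0, 1]`. -/
theorem SupportLE.of_hockeyStick_le [IsProbabilityMeasure μ] [IsProbabilityMeasure ν]
    [IsProbabilityMeasure P] [IsProbabilityMeasure Q]
    (h : ∀ α : ℝ≥0, hockeyStick α μ ν ≤ hockeyStick α P Q) : SupportLE μ ν P Q := by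
  intro a b K hK A hA
  have huniv := hK Set.univ MeasurableSet.univ
  have hempty := hK ∅ MeasurableSet.empty
  simp only [probReal_univ, measureReal_empty, mul_one, mul_zero, add_zero] at huniv hempty
  have hμ0 : 0 ≤ μ.real A := measureReal_nonneg
  have hν0 : 0 ≤ ν.real A := measureReal_nonneg
  have hμ1 : μ.real A ≤ 1 := measureReal_le_one
  have hν1 : ν.real A ≤ 1 := measureReal_le_one
  rcases le_or_gt a 0 with ha | ha
  · rcases le_or_gt b 0 with hb | hb
    · nlinarith
    · rcases ha.eq_or_lt with rfl | ha
      · nlinarith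
      -- Complements reflect the range through `(1/2, 1/2)`, which reverses both signs and shifts
      -- the bound by `a + b`.
      have hK' : ∀ B, MeasurableSet B → -a * P.real B + -b * Q.real B ≤ K - a - b := by
        intro B hB
        have := hK Bᶜ hB.compl
        rw [probReal_compl_eq_one_sub hB, probReal_compl_eq_one_sub hB] at this
        linarith
      have := mul_add_mul_le_of_hockeyStick_le h (neg_pos.2 ha) (neg_nonpos.2 hb.le) hK' hA.compl
      rw [probReal_compl_eq_one_sub hA, probReal_compl_eq_one_sub hA] at this
      linarith
  · rcases le_or_gt b 0 with hb | hb
    · exact mul_add_mul_le_of_hockeyStick_le h ha hb hK hA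
    · nlinarith

theorem Dominates.supportLE {𝒟 : Type*} {R : 𝒟 → 𝒟 → Prop} {M : 𝒟 → Measure 𝒪}
    [∀ D, IsProbabilityMeasure (M D)] [IsProbabilityMeasure P] [IsProbabilityMeasure Q]
    (h : Dominates R M P Q) {D D' : 𝒟} (hD : R D D') : SupportLE (M D) (M D') P Q :=
  .of_hockeyStick_le fun α => le_trans
    (le_iSup_of_le D (le_iSup_of_le D' (le_iSup (fun _ : R D D' => hockeyStick α (M D) (M D')) hD)))
    (h α)

theorem Dominates.of_supportLE {𝒟 : Type*} {R : 𝒟 → 𝒟 → Prop} {M : 𝒟 → Measure 𝒪}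
    [∀ D, IsFiniteMeasure (M D)] [IsFiniteMeasure P] [IsFiniteMeasure Q]
    (h : ∀ D D', R D D' → SupportLE (M D) (M D') P Q) : Dominates R M P Q :=
  fun α => iSup_le fun D => iSup_le fun D' => iSup_le fun hD => (h D D' hD).hockeyStick_le α

instance isFiniteMeasure_mix (γ : ℝ≥0) [IsFiniteMeasure P] [IsFiniteMeasure Q] :
    IsFiniteMeasure (mix γ P Q) := by
  unfold mix; infer_instance

theorem mix_real_apply {γ : ℝ≥0} (hγ : γ ≤ 1) [IsFiniteMeasure P] [IsFiniteMeasure Q]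
    (B : Set 𝒴) : (mix γ P Q).real B = (1 - γ) * P.real B + γ * Q.real B := by
  rw [mix, measureReal_add_apply, measureReal_nnreal_smul_apply, measureReal_nnreal_smul_apply,
    NNReal.coe_sub hγ, NNReal.coe_one]

theorem SupportLE.mix {γ : ℝ≥0} (hγ : γ ≤ 1) [IsFiniteMeasure P] [IsFiniteMeasure Q]
    (h : SupportLE μ ν P Q)
    (hρ : ∀ A, MeasurableSet A → ρ.real A = (1 - γ) * μ.real A + γ * ν.real A) :
    SupportLE μ ρ P (mix γ P Q) := by
  intro a b K hK A hA
  -- These are the coefficients of `(a, b)` pulled back along `(p, q) ↦ (p, (1 - γ) p + γ q)`.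
  have := h (a + b * (1 - γ)) (b * γ) K (fun B hB => by
    have := hK B hB
    rw [mix_real_apply hγ] at this
    linarith) A hA
  rw [hρ A hA]
  linarith

theorem SupportLE.mix_zero [IsProbabilityMeasure μ] [IsProbabilityMeasure P]
    [IsFiniteMeasure Q] : SupportLE μ μ P (DominatingPair.mix 0 P Q) := by
  intro a b K hK A hA
  have huniv := hK Set.univ MeasurableSet.univ
  have hempty := hK ∅ MeasurableSet.empty
  simp [mix_real_apply] at huniv hempty
  have hμ0 : 0 ≤ μ.real A := measureReal_nonneg
  have hμ1 : μ.real A ≤ 1 := measureReal_le_one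
  rcases le_or_gt (a + b) 0 with hab | hab <;> nlinarith

end SupportLE

/-! ### Expectations under discrete distributions -/

section Mean

/-- The expectation of `f` under the discrete distribution `p`. -/
noncomputable def mean {ι : Type*} (p : PMF ι) (f : ι → ℝ≥0∞) : ℝ≥0∞ := ∑' i, p i * f i

variable {ι κ : Type*}

theorem mean_const (p : PMF ι) (c : ℝ≥0∞) : mean p (fun _ => c) = c := by
  rw [mean, ENNReal.tsum_mul_right, p.tsum_coe, one_mul]

theorem mean_pure (i : ι) (f : ι → ℝ≥0∞) : mean (PMF.pure i) f = f i := by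
  rw [mean, tsum_eq_single i]
  · simp
  · intro j hj
    simp [PMF.pure_apply, hj]

theorem mean_bind (p : PMF ι) (g : ι → PMF κ) (f : κ → ℝ≥0∞) :
    mean (p.bind g) f = mean p fun i => mean (g i) f := by
  simp only [mean, PMF.bind_apply, ← ENNReal.tsum_mul_right, ← ENNReal.tsum_mul_left]
  rw [ENNReal.tsum_comm]
  simp only [mul_assoc]

theorem mean_map (p : PMF ι) (g : ι → κ) (f : κ → ℝ≥0∞) :
    mean (p.map g) f = mean p fun i => f (g i) := by
  rw [← PMF.bind_pure_comp, mean_bind]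
  simp only [Function.comp_apply, mean_pure]

theorem mean_coin {γ : ℝ≥0} (hγ : γ ≤ 1) (f : Bool → ℝ≥0∞) :
    mean (coin γ hγ) f = ((1 - γ : ℝ≥0) : ℝ≥0∞) * f false + γ * f true := by
  rw [mean, tsum_bool]
  rfl

theorem toReal_mean (p : PMF ι) {f : ι → ℝ≥0∞} (hf : ∀ i, f i ≤ 1) :
    (mean p f).toReal = ∑' i, (p i).toReal * (f i).toReal := by
  rw [mean, ENNReal.tsum_toReal_eq]
  · simp only [ENNReal.toReal_mul]
  · exact fun i => ENNReal.mul_ne_top (p.apply_ne_top i)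
      (ne_top_of_le_ne_top ENNReal.one_ne_top (hf i))

theorem summable_toReal_mul (p : PMF ι) {f : ι → ℝ≥0∞} (hf : ∀ i, f i ≤ 1) :
    Summable fun i => (p i).toReal * (f i).toReal := by
  refine Summable.of_nonneg_of_le (fun i => by positivity) (fun i => ?_)
    (ENNReal.summable_toReal p.tsum_coe_ne_top)
  exact mul_le_of_le_one_right ENNReal.toReal_nonneg
    (by simpa using ENNReal.toReal_mono ENNReal.one_ne_top (hf i))

theorem mul_mean_add_mul_mean_le (p : PMF ι) {f g : ι → ℝ≥0∞} (hf : ∀ i, f i ≤ 1)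
    (hg : ∀ i, g i ≤ 1) {a b K : ℝ} (h : ∀ i, a * (f i).toReal + b * (g i).toReal ≤ K) :
    a * (mean p f).toReal + b * (mean p g).toReal ≤ K := by
  have hsf := (summable_toReal_mul p hf).mul_left a
  have hsg := (summable_toReal_mul p hg).mul_left b
  have hp : ∑' i, (p i).toReal = 1 := by
    rw [← ENNReal.tsum_toReal_eq p.apply_ne_top, p.tsum_coe, ENNReal.toReal_one]
  have hsp := ENNReal.summable_toReal p.tsum_coe_ne_top
  rw [toReal_mean p hf, toReal_mean p hg, ← tsum_mul_left, ← tsum_mul_left,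
    ← hsf.tsum_add hsg]
  calc _ ≤ ∑' i, (p i).toReal * K := by
        refine (hsf.add hsg).tsum_le_tsum (fun i => ?_) (hsp.mul_right K)
        have := mul_le_mul_of_nonneg_left (h i) (ENNReal.toReal_nonneg (a := p i))
        linarith
    _ = K := by rw [tsum_mul_right, hp, one_mul]

variable {𝒪 𝒟 𝒟' : Type*} [MeasurableSpace 𝒪]

theorem subsampled_apply (M : 𝒟 → Measure 𝒪) (S : 𝒟' → PMF 𝒟) (D : 𝒟') {A : Set 𝒪}
    (hA : MeasurableSet A) : subsampled M S D A = mean (S D) fun E => M E A := by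
  simp [subsampled, mean, Measure.sum_apply _ hA]

instance isProbabilityMeasure_subsampled (M : 𝒟 → Measure 𝒪)
    [∀ D, IsProbabilityMeasure (M D)] (S : 𝒟' → PMF 𝒟) (D : 𝒟') :
    IsProbabilityMeasure (subsampled M S D) :=
  ⟨by simp [subsampled_apply M S D MeasurableSet.univ, mean_const]⟩

end Mean

/-! ### Poisson sampling -/

section Poisson

variable {Z : Type*} {γ : ℝ≥0} (hγ : γ ≤ 1)

theorem mean_poissonSample_cons (x : Z) (l : List Z) (f : List Z → ℝ≥0∞) :
    mean (poissonSample γ hγ (x :: l)) f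
      = ((1 - γ : ℝ≥0) : ℝ≥0∞) * mean (poissonSample γ hγ l) f
        + γ * mean (poissonSample γ hγ l) fun E => f (x :: E) := by
  rw [poissonSample, mean_bind, mean_coin]
  simp [mean_map]

theorem mean_poissonSample_append (l₁ l₂ : List Z) (f : List Z → ℝ≥0∞) :
    mean (poissonSample γ hγ (l₁ ++ l₂)) f
      = mean (poissonSample γ hγ l₁) fun E₁ => mean (poissonSample γ hγ l₂) fun E₂ =>
        f (E₁ ++ E₂) := by
  induction l₁ generalizing f with
  | nil => simp [poissonSample, mean_pure]
  | cons x l ih => simp only [List.cons_append, mean_poissonSample_cons, ih]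

/-- Independent Poisson samples of two datasets. -/
noncomputable def poissonSamplePair (γ : ℝ≥0) (hγ : γ ≤ 1) (l₁ l₂ : List Z) :
    PMF (List Z × List Z) :=
  (poissonSample γ hγ l₁).bind fun E₁ => (poissonSample γ hγ l₂).map fun E₂ => (E₁, E₂)

theorem mean_poissonSample_append_eq_pair (l₁ l₂ : List Z) (f : List Z → ℝ≥0∞) :
    mean (poissonSample γ hγ (l₁ ++ l₂)) f
      = mean (poissonSamplePair γ hγ l₁ l₂) fun E => f (E.1 ++ E.2) := by
  rw [mean_poissonSample_append, poissonSamplePair, mean_bind]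
  simp only [mean_map]

theorem mean_poissonSample_append_cons (l₁ l₂ : List Z) (x : Z) (f : List Z → ℝ≥0∞) :
    mean (poissonSample γ hγ (l₁ ++ x :: l₂)) f
      = ((1 - γ : ℝ≥0) : ℝ≥0∞) * mean (poissonSamplePair γ hγ l₁ l₂) (fun E => f (E.1 ++ E.2))
        + γ * mean (poissonSamplePair γ hγ l₁ l₂) fun E => f (E.1 ++ x :: E.2) := by
  rw [mean_poissonSample_append, poissonSamplePair, mean_bind, mean_bind]
  simp only [mean_map, mean_poissonSample_cons]
  simp only [mean, mul_add, ENNReal.tsum_add, mul_left_comm _ (γ : ℝ≥0∞),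
    mul_left_comm _ ((1 - γ : ℝ≥0) : ℝ≥0∞), ENNReal.tsum_mul_left]

theorem supportLE_poissonSample {𝒪 𝒴 : Type*} [MeasurableSpace 𝒪] [MeasurableSpace 𝒴]
    {M : List Z → Measure 𝒪} [∀ D, IsProbabilityMeasure (M D)] {P Q : Measure 𝒴}
    [IsFiniteMeasure P] [IsFiniteMeasure Q]
    (h : ∀ D D', AddNeighbor D D' → SupportLE (M D) (M D') P Q) {D D' : List Z}
    (hD : AddNeighbor D D') :
    SupportLE (subsampled M (poissonSample γ hγ) D) (subsampled M (poissonSample γ hγ) D')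
      P (mix γ P Q) := by
  obtain ⟨l₁, l₂, x, rfl, rfl⟩ := hD
  -- The sample conditioned on keeping `x`; the one-point domain only serves to fit the shape of
  -- `subsampled`.
  let N : PUnit.{1} → PMF (List Z) := fun _ =>
    (poissonSamplePair γ hγ l₁ l₂).map fun E => E.1 ++ x :: E.2
  have hN (A) (hA : MeasurableSet A) : subsampled M N ⟨⟩ A
      = mean (poissonSamplePair γ hγ l₁ l₂) fun E => M (E.1 ++ x :: E.2) A := by
    rw [subsampled_apply _ _ _ hA, mean_map]
  have h0 (A) (hA : MeasurableSet A) : subsampled M (poissonSample γ hγ) (l₁ ++ l₂) A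
      = mean (poissonSamplePair γ hγ l₁ l₂) fun E => M (E.1 ++ E.2) A := by
    rw [subsampled_apply _ _ _ hA, mean_poissonSample_append_eq_pair]
  refine SupportLE.mix (ν := subsampled M N ⟨⟩) hγ ?_ ?_
  · intro a b K hK A hA
    rw [Measure.real, Measure.real, h0 A hA, hN A hA]
    exact mul_mean_add_mul_mean_le _ (fun _ => prob_le_one) (fun _ => prob_le_one)
      fun E => h _ _ ⟨E.1, E.2, x, rfl, rfl⟩ a b K hK A hA
  · intro A hA
    have : subsampled M (poissonSample γ hγ) (l₁ ++ x :: l₂) A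
        = ((1 - γ : ℝ≥0) : ℝ≥0∞) * subsampled M (poissonSample γ hγ) (l₁ ++ l₂) A
          + γ * subsampled M N ⟨⟩ A := by
      rw [h0 A hA, hN A hA, subsampled_apply _ _ _ hA, mean_poissonSample_append_cons]
    rw [Measure.real, this, ENNReal.toReal_add, ENNReal.toReal_mul, ENNReal.toReal_mul,
      ENNReal.coe_toReal, ENNReal.coe_toReal, NNReal.coe_sub hγ, NNReal.coe_one]
    · rfl
    all_goals exact ENNReal.mul_ne_top ENNReal.coe_ne_top (measure_ne_top _ _)

end Poisson

/-! ### Subset sampling -/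

section Subset

open Finset

theorem sublistsLen_map {ι Z : Type*} (v : ι → Z) (m : ℕ) (l : List ι) :
    List.sublistsLen m (l.map v) = (List.sublistsLen m l).map (List.map v) := by
  induction l generalizing m with
  | nil => cases m <;> simp
  | cons i l ih =>
    cases m with
    | zero => simp
    | succ m => simp [List.sublistsLen_succ_cons, ih]

variable {ι Z : Type*} [DecidableEq ι]

theorem filter_mem_eq_of_sublist {l I : List ι} (hI : I.Nodup) (h : l.Sublist I) :
    I.filter (· ∈ l) = l := by
  have h1 : l.Sublist (I.filter (· ∈ l)) := by
    have := h.filter (· ∈ l)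
    rwa [List.filter_eq_self.2 (by simp)] at this
  refine (h1.eq_of_length_le ?_).symm
  exact ((List.Nodup.filter _ hI).subperm (by intro i; simp)).length_le

theorem toFinset_filter_mem {I : List ι} {S : Finset ι} (hS : S ⊆ I.toFinset) :
    (I.filter (· ∈ S)).toFinset = S := by
  ext i
  simp only [List.mem_toFinset, List.mem_filter, decide_eq_true_eq, and_iff_right_iff_imp]
  exact fun hi => List.mem_toFinset.1 (hS hi)

theorem coe_sublistsLen_eq_map_powersetCard {I : List ι} (hI : I.Nodup) (m : ℕ) :
    (↑(List.sublistsLen m I) : Multiset (List ι))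
      = (powersetCard m I.toFinset).val.map fun S => I.filter (· ∈ S) := by
  refine (Multiset.Nodup.ext (Multiset.coe_nodup.2 (List.nodup_sublistsLen m hI)) ?_).2 ?_
  · refine Multiset.Nodup.map_on (fun S hS T hT hST => ?_) (powersetCard m I.toFinset).nodup
    rw [mem_val, mem_powersetCard] at hS hT
    rw [← toFinset_filter_mem hS.1, hST, toFinset_filter_mem hT.1]
  · intro l
    simp only [Multiset.mem_coe, List.mem_sublistsLen, Multiset.mem_map, mem_val,
      mem_powersetCard]
    constructor
    · rintro ⟨hl, hm⟩
      refine ⟨l.toFinset, ⟨fun i hi => ?_, ?_⟩, ?_⟩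
      · rw [List.mem_toFinset] at hi ⊢
        exact hl.subset hi
      · rw [List.toFinset_card_of_nodup (hI.sublist hl), hm]
      · simpa using filter_mem_eq_of_sublist hI hl
    · rintro ⟨S, ⟨hS, hm⟩, rfl⟩
      refine ⟨List.filter_sublist, ?_⟩
      rw [← List.toFinset_card_of_nodup (hI.filter _), toFinset_filter_mem hS, hm]

theorem mean_ofMultiset (s : Multiset ι) (hs : s ≠ 0) (f : ι → ℝ≥0∞) :
    mean (PMF.ofMultiset s hs) f = (s.map f).sum / s.card := by
  rw [mean, tsum_eq_sum (s := s.toFinset), Finset.sum_multiset_map_count, div_eq_mul_inv,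
    Finset.sum_mul]
  · refine Finset.sum_congr rfl fun i _ => ?_
    rw [PMF.ofMultiset_apply, nsmul_eq_mul, div_eq_mul_inv, mul_right_comm]
    congr
  · intro i hi
    rw [PMF.ofMultiset_apply_of_notMem _ (by simpa using hi), zero_mul]

/-- Data points may coincide, so positions are modelled by a duplicate-free index list `I`; choices
of positions then become finite sets. -/
theorem mean_subsetSample {n m : ℕ} (hm : m < n) (D : SizedDataset Z n) {I : List ι}
    (hI : I.Nodup) (v : ι → Z) (hD : D.1 = I.map v) (f : List Z → ℝ≥0∞) :
    mean (subsetSample n m hm D) f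
      = (∑ S ∈ powersetCard m I.toFinset, f ((I.filter (· ∈ S)).map v))
        / (I.length.choose m : ℕ) := by
  classical
  rw [subsetSample, mean_ofMultiset, Multiset.coe_card, List.length_sublistsLen, hD,
    List.length_map, sublistsLen_map, ← Multiset.map_coe,
    coe_sublistsLen_eq_map_powersetCard hI, Multiset.map_map, Multiset.map_map]
  rfl

theorem subsampled_subsetSample_real {𝒪 : Type*} [MeasurableSpace 𝒪] (M : List Z → Measure 𝒪)
    [∀ D, IsProbabilityMeasure (M D)] {n m : ℕ} (hm : m < n) (D : SizedDataset Z n) {I : List ι}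
    (hI : I.Nodup) (v : ι → Z) (hD : D.1 = I.map v) {A : Set 𝒪} (hA : MeasurableSet A) :
    (subsampled M (subsetSample n m hm) D).real A
      = (∑ S ∈ powersetCard m I.toFinset, (M ((I.filter (· ∈ S)).map v)).real A)
        / (I.length.choose m : ℕ) := by
  rw [Measure.real, subsampled_apply _ _ _ hA, mean_subsetSample hm D hI v hD,
    ENNReal.toReal_div, ENNReal.toReal_sum fun _ _ => measure_ne_top _ _, ENNReal.toReal_natCast]
  rfl

/-- Double counting: a set with a marked element is a smaller set with a marked outside element. -/
theorem sum_powersetCard_sum_erase {α : Type*} [AddCommMonoid α] (U : Finset ι) (m : ℕ)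
    (f : Finset ι → Finset ι → α) :
    ∑ S ∈ powersetCard (m + 1) U, ∑ y ∈ S, f S (S.erase y)
      = ∑ T ∈ powersetCard m U, ∑ y ∈ U \ T, f (insert y T) T := by
  rw [Finset.sum_sigma', Finset.sum_sigma']
  refine Finset.sum_bij' (fun x _ => ⟨x.1.erase x.2, x.2⟩) (fun x _ => ⟨insert x.2 x.1, x.2⟩)
    ?_ ?_ ?_ ?_ ?_
  · rintro ⟨S, y⟩ h
    simp only [mem_sigma, mem_powersetCard, mem_sdiff] at h ⊢
    refine ⟨⟨(erase_subset _ _).trans h.1.1, ?_⟩, h.1.1 h.2, notMem_erase _ _⟩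
    rw [card_erase_of_mem h.2, h.1.2, Nat.add_sub_cancel]
  · rintro ⟨T, y⟩ h
    simp only [mem_sigma, mem_powersetCard, mem_sdiff] at h ⊢
    refine ⟨⟨insert_subset h.2.1 h.1.1, ?_⟩, mem_insert_self _ _⟩
    rw [card_insert_of_notMem h.2.2, h.1.2]
  · rintro ⟨S, y⟩ h
    simp only [mem_sigma] at h
    simp [insert_erase h.2]
  · rintro ⟨T, y⟩ h
    simp only [mem_sigma, mem_sdiff] at h
    simp [erase_insert h.2.2]
  · rintro ⟨S, y⟩ h
    simp only [mem_sigma] at h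
    simp [insert_erase h.2]

/-- A bound for all pairs `T ⊂ S` with `#S = #T + 1` passes to the uniform averages. -/
theorem average_powersetCard_le {U : Finset ι} {m : ℕ} (hm : m + 1 ≤ #U) {f g : Finset ι → ℝ}
    {a b K : ℝ} (h : ∀ T ⊆ U, ∀ y ∈ U, y ∉ T → a * f (insert y T) + b * g T ≤ K) :
    a * ((∑ S ∈ powersetCard (m + 1) U, f S) / ((#U).choose (m + 1) : ℕ))
      + b * ((∑ T ∈ powersetCard m U, g T) / ((#U).choose m : ℕ)) ≤ K := by
  have h1 : ∑ S ∈ powersetCard (m + 1) U, ∑ y ∈ S, (a * f S + b * g (S.erase y))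
      ≤ ∑ S ∈ powersetCard (m + 1) U, ∑ y ∈ S, K := by
    refine Finset.sum_le_sum fun S hS => Finset.sum_le_sum fun y hy => ?_
    have hSU := (mem_powersetCard.1 hS).1
    have := h (S.erase y) ((erase_subset _ _).trans hSU) y (hSU hy) (notMem_erase _ _)
    rwa [insert_erase hy] at this
  have hf : ∑ S ∈ powersetCard (m + 1) U, ∑ _y ∈ S, a * f S
      = a * ((m + 1) * ∑ S ∈ powersetCard (m + 1) U, f S) := by
    rw [Finset.mul_sum, Finset.mul_sum]
    refine Finset.sum_congr rfl fun S hS => ?_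
    rw [sum_const, (mem_powersetCard.1 hS).2, nsmul_eq_mul]
    push_cast; ring
  have hg : ∑ S ∈ powersetCard (m + 1) U, ∑ y ∈ S, b * g (S.erase y)
      = b * ((#U - m) * ∑ T ∈ powersetCard m U, g T) := by
    rw [sum_powersetCard_sum_erase U m fun _ T => b * g T, Finset.mul_sum, Finset.mul_sum]
    refine Finset.sum_congr rfl fun T hT => ?_
    obtain ⟨hTU, hTm⟩ := mem_powersetCard.1 hT
    rw [sum_const, card_sdiff_of_subset hTU, hTm, nsmul_eq_mul, Nat.cast_sub (by omega)]
    ring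
  have hK : ∑ S ∈ powersetCard (m + 1) U, ∑ _y ∈ S, K
      = ((#U).choose (m + 1) : ℕ) * ((m + 1) * K) := by
    rw [← card_powersetCard, ← nsmul_eq_mul, ← sum_const]
    refine Finset.sum_congr rfl fun S hS => ?_
    rw [sum_const, (mem_powersetCard.1 hS).2, nsmul_eq_mul]
    push_cast; ring
  simp only [Finset.sum_add_distrib] at h1
  rw [hf, hg, hK] at h1
  -- Both sides count the pairs `T ⊂ S`, so a uniform pair has uniform marginals `S` and `T`.
  have hc : (((#U).choose (m + 1) : ℕ) : ℝ) * (m + 1) = ((#U).choose m : ℕ) * (#U - m) := by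
    have := Nat.choose_succ_right_eq #U m
    rw [← Nat.cast_sub (by omega : m ≤ #U)]
    exact_mod_cast this
  have hpos : (0 : ℝ) < ((#U).choose (m + 1) : ℕ) := by exact_mod_cast Nat.choose_pos hm
  have hpos' : (0 : ℝ) < ((#U).choose m : ℕ) := by exact_mod_cast Nat.choose_pos (by omega)
  set F := ∑ S ∈ powersetCard (m + 1) U, f S
  set G := ∑ T ∈ powersetCard m U, g T
  set C := (((#U).choose (m + 1) : ℕ) : ℝ)
  set C' := (((#U).choose m : ℕ) : ℝ)
  have hm1 : (0 : ℝ) < m + 1 := by positivity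
  have hG : (#U - m : ℝ) * G = (C * (m + 1)) * (G / C') := by
    rw [hc]; field_simp
  have hF : F = C * (F / C) := by field_simp
  rw [hG, hF] at h1
  refine le_of_mul_le_mul_left ?_ (mul_pos hpos hm1)
  linarith

theorem filter_mem_insert_of_notMem {l : List ι} {y : ι} (hy : y ∉ l) (T : Finset ι) :
    l.filter (· ∈ insert y T) = l.filter (· ∈ T) := by
  refine List.filter_congr fun i hi => ?_
  have : i ≠ y := fun h => hy (h ▸ hi)
  simp [this]

theorem filter_mem_insert_of_nodup {I : List ι} (hI : I.Nodup) {y : ι} (hy : y ∈ I)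
    {T : Finset ι} (hT : y ∉ T) :
    ∃ l₁ l₂, I.filter (· ∈ insert y T) = l₁ ++ y :: l₂ ∧ I.filter (· ∈ T) = l₁ ++ l₂ := by
  obtain ⟨J₁, J₂, rfl⟩ := List.append_of_mem hy
  rw [List.nodup_middle, List.nodup_cons, List.mem_append, not_or] at hI
  refine ⟨J₁.filter (· ∈ T), J₂.filter (· ∈ T), ?_, ?_⟩
  · rw [List.filter_append, List.filter_cons_of_pos (by simp),
      filter_mem_insert_of_notMem hI.1.1, filter_mem_insert_of_notMem hI.1.2]
  · rw [List.filter_append, List.filter_cons_of_neg (by simpa using hT)]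

/-- The common intermediate dataset is the one selected by `T`: `y` is deleted, then `k` is inserted
at its own position. -/
theorem replaceNeighbor_filter_insert (v : ι → Z) {I₁ I₂ : List ι} {k : ι}
    (hI : (I₁ ++ I₂).Nodup) {T : Finset ι} {y : ι} (hy : y ∈ I₁ ++ I₂) (hT : y ∉ T) :
    ReplaceNeighbor (((I₁ ++ I₂).filter (· ∈ insert y T)).map v)
      ((I₁.filter (· ∈ T) ++ k :: I₂.filter (· ∈ T)).map v) := by
  obtain ⟨l₁, l₂, h1, h2⟩ := filter_mem_insert_of_nodup hI hy hT
  refine ⟨((I₁ ++ I₂).filter (· ∈ T)).map v, ⟨l₁.map v, l₂.map v, v y, ?_, ?_⟩,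
    ⟨(I₁.filter (· ∈ T)).map v, (I₂.filter (· ∈ T)).map v, v k, ?_, ?_⟩⟩
  · rw [h2, List.map_append]
  · rw [h1, List.map_append, List.map_cons]
  · rw [List.filter_append, List.map_append]
  · rw [List.map_append, List.map_cons]

theorem exists_nodup_index (l₁ l₂ : List Z) (x : Z) :
    ∃ (N : ℕ) (v : Fin N → Z) (I₁ I₂ : List (Fin N)) (k : Fin N), (I₁ ++ k :: I₂).Nodup ∧
      l₁ = I₁.map v ∧ x = v k ∧ l₂ = I₂.map v := by
  have h := List.map_get_finRange (l₁ ++ x :: l₂)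
  have hnd := List.nodup_finRange (l₁ ++ x :: l₂).length
  obtain ⟨I₁, J, hJ, h1, h2⟩ := List.map_eq_append_iff.1 h
  obtain ⟨k, I₂, rfl, h3, h4⟩ := List.map_eq_cons_iff.1 h2
  exact ⟨_, _, I₁, I₂, k, hJ ▸ hnd, h1.symm, h3.symm, h4.symm⟩

/-- Splitting the subsets of `I₁ ++ k :: I₂` by whether they contain `k`. -/
theorem sum_powersetCard_append_cons {α : Type*} [AddCommMonoid α] {I₁ I₂ : List ι} {k : ι}
    (hI : (I₁ ++ k :: I₂).Nodup) (m : ℕ) (f : List ι → α) :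
    ∑ S ∈ powersetCard (m + 1) (I₁ ++ k :: I₂).toFinset, f ((I₁ ++ k :: I₂).filter (· ∈ S))
      = ∑ S ∈ powersetCard (m + 1) (I₁ ++ I₂).toFinset, f ((I₁ ++ I₂).filter (· ∈ S))
        + ∑ T ∈ powersetCard m (I₁ ++ I₂).toFinset,
            f (I₁.filter (· ∈ T) ++ k :: I₂.filter (· ∈ T)) := by
  rw [List.nodup_middle, List.nodup_cons] at hI
  have hk : k ∉ (I₁ ++ I₂).toFinset := by rw [List.mem_toFinset]; exact hI.1
  have hins : (I₁ ++ k :: I₂).toFinset = insert k (I₁ ++ I₂).toFinset := by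
    ext i; simp
  rw [hins, powersetCard_succ_insert hk, sum_union, sum_image]
  · congr 1
    · refine Finset.sum_congr rfl fun S hS => ?_
      have hkS : k ∉ S := fun h => hk ((mem_powersetCard.1 hS).1 h)
      rw [List.filter_append, List.filter_cons_of_neg (by simpa using hkS), List.filter_append]
    · refine Finset.sum_congr rfl fun T hT => ?_
      replace hI := hI.1
      rw [List.mem_append, not_or] at hI
      rw [List.filter_append, List.filter_cons_of_pos (by simp),
        filter_mem_insert_of_notMem hI.1, filter_mem_insert_of_notMem hI.2]
  · intro S hS T hT hST
    have hkS : k ∉ S := fun h => hk ((mem_powersetCard.1 hS).1 h)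
    have hkT : k ∉ T := fun h => hk ((mem_powersetCard.1 hT).1 h)
    rw [← erase_insert hkS, ← erase_insert hkT]
    exact congrArg (fun s => s.erase k) hST
  · rw [Finset.disjoint_left]
    intro S hS hS'
    obtain ⟨T, -, rfl⟩ := mem_image.1 hS'
    exact hk ((mem_powersetCard.1 hS).1 (mem_insert_self _ _))

/-- The rate `(m + 1) / (N + 1)` is the proportion of `(m + 1)`-subsets that contain a given point.
-/
theorem uniform_average_split {N m : ℕ} (hm : m + 1 ≤ N) (x y : ℝ) :
    (x + y) / ((N + 1).choose (m + 1) : ℕ)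
      = (1 - (((m + 1 : ℕ) / (N + 1 : ℕ) : ℝ≥0) : ℝ)) * (x / (N.choose (m + 1) : ℕ))
        + (((m + 1 : ℕ) / (N + 1 : ℕ) : ℝ≥0) : ℝ) * (y / (N.choose m : ℕ)) := by
  have hc : ((N : ℝ) + 1) * (N.choose m : ℕ) = ((N + 1).choose (m + 1) : ℕ) * (m + 1) := by
    exact_mod_cast Nat.add_one_mul_choose_eq N m
  have hs : (((N + 1).choose (m + 1) : ℕ) : ℝ) = (N.choose m : ℕ) + (N.choose (m + 1) : ℕ) := by
    exact_mod_cast Nat.choose_succ_succ N m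
  have h1 : (0 : ℝ) < (N.choose (m + 1) : ℕ) := by exact_mod_cast Nat.choose_pos hm
  have h2 : (0 : ℝ) < (N.choose m : ℕ) := by exact_mod_cast Nat.choose_pos (by omega)
  have hγ : (((m + 1 : ℕ) / (N + 1 : ℕ) : ℝ≥0) : ℝ)
      = (N.choose m : ℕ) / ((N + 1).choose (m + 1) : ℕ) := by
    have h3 : (0 : ℝ) < ((N + 1).choose (m + 1) : ℕ) := by rw [hs]; positivity
    push_cast
    rw [div_eq_div_iff (by positivity) h3.ne']
    linarith
  rw [hγ, hs]
  field_simp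
  ring

theorem supportLE_subsetSample {𝒪 𝒴 : Type*} [MeasurableSpace 𝒪] [MeasurableSpace 𝒴]
    {M : List Z → Measure 𝒪} [∀ D, IsProbabilityMeasure (M D)] {P Q : Measure 𝒴}
    [IsProbabilityMeasure P] [IsProbabilityMeasure Q]
    (h : ∀ D D', ReplaceNeighbor D D' → SupportLE (M D) (M D') P Q) {n m : ℕ} (hm : m < n)
    {D D' : SizedDataset Z n} (hD : AddNeighbor D.1 D'.1) :
    SupportLE (subsampled M (subsetSample n m hm) D) (subsampled M (subsetSample n m hm) D')
      P (mix ((m : ℝ≥0) / (n : ℝ≥0)) P Q) := by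
  obtain ⟨l₁, l₂, x, h1, h2⟩ := hD
  obtain ⟨L, v, I₁, I₂, k, hI, rfl, rfl, rfl⟩ := exists_nodup_index l₁ l₂ x
  rw [← List.map_append] at h1
  rw [← List.map_cons, ← List.map_append] at h2
  have hI' : (I₁ ++ I₂).Nodup := (List.nodup_cons.1 (List.nodup_middle.1 hI)).2
  cases m with
  -- Here every sample is empty and `γ = 0`, so no neighbouring pair is needed.
  | zero =>
    have : subsampled M (subsetSample n 0 hm) D' = subsampled M (subsetSample n 0 hm) D := by
      ext A hA
      rw [subsampled_apply _ _ _ hA, subsampled_apply _ _ _ hA,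
        mean_subsetSample hm D hI' v h1, mean_subsetSample hm D' hI v h2]
      simp
    rw [this, Nat.cast_zero, zero_div]
    exact SupportLE.mix_zero
  | succ m =>
    obtain ⟨N, rfl⟩ : ∃ N, n = N + 1 := ⟨n - 1, by omega⟩
    have hlen : (I₁ ++ k :: I₂).length = (I₁ ++ I₂).length + 1 := by simp; omega
    -- `D'` is longer by one and both sizes lie in `{n - 1, n}`, which forces `D` to have size `n -
    -- 1`.
    have hN : (I₁ ++ I₂).length = N := by
      have e1 := D.2
      have e2 := D'.2
      rw [h1, List.length_map] at e1
      rw [h2, List.length_map, hlen] at e2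
      omega
    have hcard : #(I₁ ++ I₂).toFinset = N := by rw [List.toFinset_card_of_nodup hI', hN]
    have hmN : m + 1 ≤ N := by omega
    have hγ : ((m + 1 : ℕ) / (N + 1 : ℕ) : ℝ≥0) ≤ 1 :=
      div_le_one_of_le₀ (by exact_mod_cast hm.le) zero_le
    intro a b K hK A hA
    have hpair : ∀ T ⊆ (I₁ ++ I₂).toFinset, ∀ y ∈ (I₁ ++ I₂).toFinset, y ∉ T → _ :=
      fun T _ y hy hyT => (h _ _ (replaceNeighbor_filter_insert v (k := k) hI'
        (List.mem_toFinset.1 hy) hyT))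
    set γ : ℝ≥0 := (m + 1 : ℕ) / (N + 1 : ℕ)
    have key := average_powersetCard_le (U := (I₁ ++ I₂).toFinset) (m := m) (by omega)
      (f := fun S => (M (((I₁ ++ I₂).filter (· ∈ S)).map v)).real A)
      (g := fun T => (M ((I₁.filter (· ∈ T) ++ k :: I₂.filter (· ∈ T)).map v)).real A)
      (a := a + b * (1 - γ)) (b := b * γ) (K := K)
      fun T hT y hy hyT => hpair T hT y hy hyT _ _ K (fun B hB => by
        have := hK B hB
        rw [mix_real_apply hγ] at this
        linarith) A hA
    rw [subsampled_subsetSample_real M hm D hI' v h1 hA,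
      subsampled_subsetSample_real M hm D' hI v h2 hA,
      sum_powersetCard_append_cons hI m fun l => (M (l.map v)).real A, hlen, hN,
      uniform_average_split hmN]
    rw [hcard] at key
    linarith

end Subset

end DominatingPair

theorem mainTheorem2 {Z 𝒪 𝒴 : Type*} [MeasurableSpace 𝒪] [MeasurableSpace 𝒴]
    (M : List Z → Measure 𝒪) (hM : ∀ D, IsProbabilityMeasure (M D))
    (P Q : Measure 𝒴) (hP : IsProbabilityMeasure P) (hQ : IsProbabilityMeasure Q) :
    -- Poisson sampling
    (∀ (γ : ℝ≥0) (hγ : γ ≤ 1),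
      (DominatingPair.Dominates DominatingPair.AddNeighbor M P Q →
        DominatingPair.Dominates DominatingPair.AddNeighbor
          (DominatingPair.subsampled M (DominatingPair.poissonSample γ hγ))
          P (DominatingPair.mix γ P Q) ∧
        DominatingPair.Dominates DominatingPair.RemoveNeighbor
          (DominatingPair.subsampled M (DominatingPair.poissonSample γ hγ))
          (DominatingPair.mix γ P Q) P) ∧
      (DominatingPair.Dominates DominatingPair.RemoveNeighbor M P Q →
        DominatingPair.Dominates DominatingPair.RemoveNeighbor
          (DominatingPair.subsampled M (DominatingPair.poissonSample γ hγ))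
          (DominatingPair.mix γ Q P) Q)) ∧
    -- subset sampling, with sampling rate `m / n`
    (∀ (n m : ℕ) (hm : m < n),
      DominatingPair.Dominates DominatingPair.ReplaceNeighbor M P Q →
        DominatingPair.Dominates
          (fun D D' : DominatingPair.SizedDataset Z n => DominatingPair.AddNeighbor D.1 D'.1)
          (DominatingPair.subsampled M (DominatingPair.subsetSample n m hm))
          P (DominatingPair.mix ((m : ℝ≥0) / (n : ℝ≥0)) P Q) ∧
        DominatingPair.Dominates
          (fun D D' : DominatingPair.SizedDataset Z n => DominatingPair.RemoveNeighbor D.1 D'.1)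
          (DominatingPair.subsampled M (DominatingPair.subsetSample n m hm))
          (DominatingPair.mix ((m : ℝ≥0) / (n : ℝ≥0)) P Q) P) := by
  have := hM
  refine ⟨fun γ hγ => ⟨fun h => ?_, fun h => ?_⟩, fun n m hm h => ?_⟩
  · have key := fun D D' hD => DominatingPair.supportLE_poissonSample hγ
      (fun _ _ => h.supportLE) (D := D) (D' := D') hD
    exact ⟨.of_supportLE key, .of_supportLE fun D D' hD => (key D' D hD).swap⟩
  -- Swapped, the removal hypothesis says that `(Q, P)` bounds add neighbours; the result is swapped
  -- back.
  · exact .of_supportLE fun D D' hD => (DominatingPair.supportLE_poissonSample hγ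
      (fun E E' hE => (h.supportLE (D := E') (D' := E) hE).swap) hD).swap
  · have key := fun D D' hD => DominatingPair.supportLE_subsetSample
      (fun _ _ => h.supportLE) hm (D := D) (D' := D') hD
    exact ⟨.of_supportLE key, .of_supportLE fun D D' hD => (key D' D hD).swap⟩
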